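/- For a binary matrix $M\in\{0,1\}^{m\times n}$ ($m,n\ge 1$) let $|M|$ denote the number of its $1$ entries, let $p(M)=\frac{|M|}{mn}$ be its density, and define its discrepancy by $$\mathrm{disc}(M)=\max_{X\subseteq[m],\,Y\subseteq[n]}\Big||M[X\times Y]|-p(M)\,|X|\,|Y|\Big|,$$ where $M[X\times Y]$ is the submatrix of $M$ with row set $X$ and column set $Y$. Rank means rank over $\mathbb{R}$. (1) There is an absolute constant $c>0$ such that for all integers $m,n,r\ge 1$ and every $M\in\{0,1\}^{m\times n}$ with $\mathrm{rank}(M)\le r$ and $p=p(M)\le \frac12$, $$\mathrm{disc}(M)\ \ge\ c\,mn\cdot\min\left\{p,\ \frac{p^{1/2}}{\sqrt r}\right\}.$$ (2) This bound is tight up to the constant: there is an absolute constant $C>0$ such that for all integers $r\ge 1$ and $m,n\ge r$ and every real $p_0$ with $\frac1{mn}\le p_0\le\frac12$ there is a matrix $M\in\{0,1\}^{m\times n}$ with $\mathrm{rank}(M)\le r$, density $p=p(M)\in[p_0/2,\,p_0]$ and $$\mathrm{disc}(M)\ \le\ C\,mn\cdot\min\left\{p,\ \frac{p^{1/2}}{\sqrt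 r}\right\}.$$ -/

import Mathlib

namespace MatrixDisc

/-- A real matrix is binary if each of its entries is `0` or `1`. -/
def IsBinary {m n : ℕ} (M : Matrix (Fin m) (Fin n) ℝ) : Prop :=
  ∀ i j, M i j = 0 ∨ M i j = 1

open Classical in
/-- The number of `1` entries of the submatrix of `M` with rows `X` and columns `Y`. -/
noncomputable def onesIn {m n : ℕ} (M : Matrix (Fin m) (Fin n) ℝ)
    (X : Finset (Fin m)) (Y : Finset (Fin n)) : ℕ :=
  ((X ×ˢ Y).filter fun e => M e.1 e.2 = 1).card

/-- The density of `M`: the number of `1` entries divided by `m * n`. -/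
noncomputable def density {m n : ℕ} (M : Matrix (Fin m) (Fin n) ℝ) : ℝ :=
  (onesIn M Finset.univ Finset.univ : ℝ) / ((m : ℝ) * (n : ℝ))

/-- The discrepancy of `M`: the maximum over all sets `X` of rows and `Y` of columns of the
absolute difference between the number of `1` entries in `X × Y` and `p |X| |Y|`, where `p` is the
density of `M`. -/
noncomputable def disc {m n : ℕ} (M : Matrix (Fin m) (Fin n) ℝ) : ℝ :=
  (Finset.univ : Finset (Finset (Fin m) × Finset (Fin n))).sup' Finset.univ_nonempty
    fun P => |(onesIn M P.1 P.2 : ℝ) - density M * (P.1.card : ℝ) * (P.2.card : ℝ)|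

end MatrixDisc

/-! Lower bound. Let `D` be the discrepancy and `A` the matrix `M - p`. Splitting into positive and
negative parts bounds the bilinear form of `A` on the cube `[-1, 1]` by `4 * D`, and Grothendieck's
inequality extends this to vectors in the unit ball at the cost of a constant. Test it on vectors
built from the singular value decomposition: the form becomes `∑ σ³`, while the vectors have exactly
the norms of the rows and columns of `A`. By Hölder, `(∑ σ²)³ ≤ rank * (∑ σ³)²`, so a large
Frobenius norm together with short rows and columns forces `D` to be large. Rows and columns of more
than twice the average weight would spoil the norm bounds, but they carry at most `4 * D` ones in
all. Hence either `D` is already of order `p * m * n`, or they can be discarded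
(`IsBinary.spectral_bound`).

Tightness. If `p * r` is bounded, the minimum is of order `p` and an all-ones block suffices, as
discrepancy never exceeds the number of ones. Otherwise a random `r × r` Bernoulli matrix has cut
deviation `O(r * √(q * r))` by an exponential moment and union bound; blowing it up to `m × n` keeps
the rank at most `r` and scales the deviation by `O(m * n / r²)`. -/

namespace MatrixDisc

open Finset

/-! ### Cut norm against bilinear forms on cubes -/

section CutNorm

variable {ι κ : Type*} [Fintype ι] [Fintype κ]

/-- A linear form on the cube `[0, 1]^ι` is bounded by its value at a vertex. -/
lemma exists_sum_mul_le_sum_subset (c x : ι → ℝ) (h0 : ∀ i, 0 ≤ x i) (h1 : ∀ i, x i ≤ 1) :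
    ∃ X : Finset ι, ∑ i, x i * c i ≤ ∑ i ∈ X, c i := by
  classical
  refine ⟨univ.filter fun i => 0 ≤ c i, ?_⟩
  rw [sum_filter]
  refine sum_le_sum fun i _ => ?_
  split_ifs with h
  · nlinarith [h0 i, h1 i]
  · nlinarith [h0 i, h1 i]

/-- The form is linear in each argument separately, so `x` and then `y` can be rounded to indicator
vectors without decreasing it. -/
lemma bilin_le_of_cut_le (B : ι → κ → ℝ) {D : ℝ}
    (hD : ∀ (X : Finset ι) (Y : Finset κ), ∑ i ∈ X, ∑ j ∈ Y, B i j ≤ D)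
    (x : ι → ℝ) (y : κ → ℝ) (hx0 : ∀ i, 0 ≤ x i) (hx1 : ∀ i, x i ≤ 1)
    (hy0 : ∀ j, 0 ≤ y j) (hy1 : ∀ j, y j ≤ 1) :
    ∑ i, ∑ j, B i j * (x i * y j) ≤ D := by
  obtain ⟨X, hX⟩ := exists_sum_mul_le_sum_subset (fun i => ∑ j, B i j * y j) x hx0 hx1
  obtain ⟨Y, hY⟩ := exists_sum_mul_le_sum_subset (fun j => ∑ i ∈ X, B i j) y hy0 hy1
  calc ∑ i, ∑ j, B i j * (x i * y j) = ∑ i, x i * ∑ j, B i j * y j := by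
        refine sum_congr rfl fun i _ => ?_
        rw [mul_sum]
        exact sum_congr rfl fun j _ => by ring
    _ ≤ ∑ i ∈ X, ∑ j, B i j * y j := hX
    _ = ∑ j, y j * ∑ i ∈ X, B i j := by
        rw [sum_comm]
        refine sum_congr rfl fun j _ => ?_
        rw [mul_sum]
        exact sum_congr rfl fun i _ => by ring
    _ ≤ ∑ j ∈ Y, ∑ i ∈ X, B i j := hY
    _ = ∑ i ∈ X, ∑ j ∈ Y, B i j := sum_comm
    _ ≤ D := hD X Y

lemma abs_bilin_le_of_abs_cut_le (B : ι → κ → ℝ) {D : ℝ}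
    (hD : ∀ (X : Finset ι) (Y : Finset κ), |∑ i ∈ X, ∑ j ∈ Y, B i j| ≤ D)
    (x : ι → ℝ) (y : κ → ℝ) (hx0 : ∀ i, 0 ≤ x i) (hx1 : ∀ i, x i ≤ 1)
    (hy0 : ∀ j, 0 ≤ y j) (hy1 : ∀ j, y j ≤ 1) :
    |∑ i, ∑ j, B i j * (x i * y j)| ≤ D := by
  rw [abs_le']
  refine ⟨bilin_le_of_cut_le B (fun X Y => (le_abs_self _).trans (hD X Y)) x y hx0 hx1 hy0 hy1, ?_⟩
  have := bilin_le_of_cut_le (fun i j => -B i j) (D := D)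
    (fun X Y => by
      have := (neg_le_abs _).trans (hD X Y)
      simpa only [sum_neg_distrib] using this) x y hx0 hx1 hy0 hy1
  simpa only [neg_mul, sum_neg_distrib] using this

/-- Splitting both arguments into positive and negative parts gives four forms on `[0, 1]`-vectors,
whence the factor 4. -/
lemma bilin_le_four_mul_of_abs_cut_le (B : ι → κ → ℝ) {D : ℝ}
    (hD : ∀ (X : Finset ι) (Y : Finset κ), |∑ i ∈ X, ∑ j ∈ Y, B i j| ≤ D)
    (x : ι → ℝ) (y : κ → ℝ) (hx : ∀ i, |x i| ≤ 1) (hy : ∀ j, |y j| ≤ 1) :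
    ∑ i, ∑ j, B i j * (x i * y j) ≤ 4 * D := by
  have p0 : ∀ t : ℝ, 0 ≤ max t 0 := fun t => le_max_right _ _
  have p1 : ∀ t : ℝ, |t| ≤ 1 → max t 0 ≤ 1 := fun t ht =>
    max_le ((le_abs_self t).trans ht) zero_le_one
  have m1 : ∀ t : ℝ, |t| ≤ 1 → max (-t) 0 ≤ 1 := fun t ht =>
    max_le ((neg_le_abs t).trans ht) zero_le_one
  have hs : ∀ t : ℝ, t = max t 0 - max (-t) 0 := fun t => by
    rcases le_total t 0 with h | h
    · rw [max_eq_right h, max_eq_left (by linarith)]; ring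
    · rw [max_eq_left h, max_eq_right (by linarith)]; ring
  have key := fun (u : ι → ℝ) (v : κ → ℝ) => abs_bilin_le_of_abs_cut_le B hD u v
  have k1 := key (fun i => max (x i) 0) (fun j => max (y j) 0) (fun i => p0 _)
    (fun i => p1 _ (hx i)) (fun i => p0 _) (fun i => p1 _ (hy i))
  have k2 := key (fun i => max (x i) 0) (fun j => max (-y j) 0) (fun i => p0 _)
    (fun i => p1 _ (hx i)) (fun i => p0 _) (fun i => m1 _ (hy i))
  have k3 := key (fun i => max (-x i) 0) (fun j => max (y j) 0) (fun i => p0 _)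
    (fun i => m1 _ (hx i)) (fun i => p0 _) (fun i => p1 _ (hy i))
  have k4 := key (fun i => max (-x i) 0) (fun j => max (-y j) 0) (fun i => p0 _)
    (fun i => m1 _ (hx i)) (fun i => p0 _) (fun i => m1 _ (hy i))
  have e : ∑ i, ∑ j, B i j * (x i * y j)
      = ∑ i, ∑ j, B i j * (max (x i) 0 * max (y j) 0)
        - ∑ i, ∑ j, B i j * (max (x i) 0 * max (-y j) 0)
        - ∑ i, ∑ j, B i j * (max (-x i) 0 * max (y j) 0)
        + ∑ i, ∑ j, B i j * (max (-x i) 0 * max (-y j) 0) := by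
    simp only [← sum_sub_distrib, ← sum_add_distrib]
    refine sum_congr rfl fun i _ => sum_congr rfl fun j _ => ?_
    conv_lhs => rw [hs (x i), hs (y j)]
    ring
  rw [e]
  rw [abs_le] at k1 k2 k3 k4
  linarith [k1.2, k2.1, k3.1, k4.2]

end CutNorm

/-! ### Second and fourth moments of Rademacher sums -/

section Rademacher

variable {κ : Type*} [DecidableEq κ]

/-- The sign `±1` attached to a Boolean. -/
def boolSign (b : Bool) : ℝ := if b then 1 else -1

lemma boolSign_sq (b : Bool) : boolSign b ^ 2 = 1 := by
  cases b <;> simp [boolSign]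

lemma boolSign_not (b : Bool) : boolSign (!b) = -boolSign b := by
  cases b <;> simp [boolSign]

lemma rademacher_update {s : Finset κ} {k : κ} (hk : k ∉ s) (a : κ → ℝ) (ω : κ → Bool) (b : Bool) :
    ∑ l ∈ s, boolSign (Function.update ω k b l) * a l = ∑ l ∈ s, boolSign (ω l) * a l := by
  refine sum_congr rfl fun l hl => ?_
  rw [Function.update_of_ne]
  rintro rfl
  exact hk hl

variable [Fintype κ]

/-- Flipping the `k`-th sign is an involution that negates every term. -/
lemma sum_boolSign_mul_eq_zero (k : κ) (g : (κ → Bool) → ℝ)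
    (hg : ∀ ω, g (Function.update ω k (!ω k)) = g ω) :
    ∑ ω : κ → Bool, boolSign (ω k) * g ω = 0 := by
  have hinv : Function.Involutive fun ω : κ → Bool => Function.update ω k (!ω k) := fun ω => by
    simp
  have h := Equiv.sum_comp hinv.toPerm fun ω : κ → Bool => boolSign (ω k) * g ω
  simp only [Function.Involutive.coe_toPerm, Function.update_self, boolSign_not, hg,
    neg_mul, sum_neg_distrib] at h
  linarith

lemma sum_rademacher_mul (a b : κ → ℝ) (s : Finset κ) :
    ∑ ω : κ → Bool, (∑ l ∈ s, boolSign (ω l) * a l) * (∑ l ∈ s, boolSign (ω l) * b l)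
      = (Fintype.card (κ → Bool) : ℝ) * ∑ l ∈ s, a l * b l := by
  induction s using Finset.induction_on with
  | empty => simp
  | insert k s hk ih =>
    have e : ∀ ω : κ → Bool,
        (∑ l ∈ insert k s, boolSign (ω l) * a l) * (∑ l ∈ insert k s, boolSign (ω l) * b l)
        = a k * b k + boolSign (ω k) * (a k * ∑ l ∈ s, boolSign (ω l) * b l
            + b k * ∑ l ∈ s, boolSign (ω l) * a l)
          + (∑ l ∈ s, boolSign (ω l) * a l) * (∑ l ∈ s, boolSign (ω l) * b l) := fun ω => by
      rw [sum_insert hk, sum_insert hk]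
      linear_combination (a k * b k) * boolSign_sq (ω k)
    simp only [e, sum_add_distrib, ih]
    rw [sum_boolSign_mul_eq_zero k _ fun ω => by
      rw [rademacher_update hk, rademacher_update hk], sum_insert hk]
    simp only [sum_const, card_univ, nsmul_eq_mul]
    ring

/-- Khintchine's inequality for the fourth moment. When a coordinate is added, the terms odd in its
sign cancel and the quadratic cross term is given by the second moment. -/
lemma sum_rademacher_pow_four_le (a : κ → ℝ) (s : Finset κ) :
    ∑ ω : κ → Bool, (∑ l ∈ s, boolSign (ω l) * a l) ^ 4
      ≤ 3 * (Fintype.card (κ → Bool) : ℝ) * (∑ l ∈ s, a l ^ 2) ^ 2 := by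
  induction s using Finset.induction_on with
  | empty => simp
  | insert k s hk ih =>
    have h2 := sum_rademacher_mul a a s
    set S : (κ → Bool) → ℝ := fun ω => ∑ l ∈ s, boolSign (ω l) * a l with hS
    have e : ∀ ω : κ → Bool,
        (∑ l ∈ insert k s, boolSign (ω l) * a l) ^ 4
        = a k ^ 4 + boolSign (ω k) * (4 * a k * S ω ^ 3 + 4 * a k ^ 3 * S ω)
          + 6 * a k ^ 2 * (S ω * S ω) + S ω ^ 4 := fun ω => by
      rw [sum_insert hk]
      change (boolSign (ω k) * a k + S ω) ^ 4 = _
      linear_combination (a k ^ 4 * (boolSign (ω k) ^ 2 + 1)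
        + 4 * a k ^ 3 * S ω * boolSign (ω k) + 6 * a k ^ 2 * S ω ^ 2) * boolSign_sq (ω k)
    have hinv : ∀ ω : κ → Bool, S (Function.update ω k (!ω k)) = S ω := fun ω =>
      rademacher_update hk a ω _
    simp only [e, sum_add_distrib, ← mul_sum]
    rw [sum_boolSign_mul_eq_zero k _ fun ω => by rw [hinv], sum_insert hk, h2]
    simp only [sum_const, card_univ, nsmul_eq_mul]
    have hc : (0 : ℝ) ≤ Fintype.card (κ → Bool) := Nat.cast_nonneg _
    have hsq : ∑ l ∈ s, a l * a l = ∑ l ∈ s, a l ^ 2 := sum_congr rfl fun l _ => by ring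
    rw [hsq]
    have : 0 ≤ (Fintype.card (κ → Bool) : ℝ) * a k ^ 4 := by positivity
    nlinarith [ih]

end Rademacher

/-! ### Grothendieck's inequality by truncation and self-improvement -/

section Grothendieck

/-- Truncation of a real number at height `T`. -/
noncomputable def truncate (T x : ℝ) : ℝ := if |x| ≤ T then x else 0

lemma abs_truncate_le {T : ℝ} (hT : 0 ≤ T) (x : ℝ) : |truncate T x| ≤ T := by
  unfold truncate
  split_ifs with h
  · exact h
  · simpa using hT

lemma truncate_sq_le (T x : ℝ) : truncate T x ^ 2 ≤ x ^ 2 := by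
  unfold truncate
  split_ifs with h
  · exact le_rfl
  · simpa using sq_nonneg x

lemma sq_sub_truncate_le {T : ℝ} (hT : 0 ≤ T) (x : ℝ) :
    T ^ 2 * (x - truncate T x) ^ 2 ≤ x ^ 4 := by
  unfold truncate
  split_ifs with h
  · have : 0 ≤ x ^ 4 := by positivity
    simpa using this
  · have : T ^ 2 ≤ x ^ 2 := by
      rw [← sq_abs x]
      exact pow_le_pow_left₀ hT (not_le.1 h).le 2
    nlinarith [sq_nonneg x]

variable {ι μ : Type*} [Fintype ι] [Fintype μ]

/-- `K` bounds the bilinear form of `A` on all families of vectors in the Euclidean unit ball. -/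
def IsVectorBound (A : ι → μ → ℝ) (K : ℝ) : Prop :=
  ∀ (κ : Type) [Fintype κ] (x : ι → κ → ℝ) (y : μ → κ → ℝ),
    (∀ i, ∑ k, x i k ^ 2 ≤ 1) → (∀ j, ∑ k, y j k ^ 2 ≤ 1) →
      ∑ i, ∑ j, A i j * ∑ k, x i k * y j k ≤ K

lemma IsVectorBound.scale {A : ι → μ → ℝ} {K : ℝ} (hK : IsVectorBound A K) {κ : Type} [Fintype κ]
    {a b : ℝ} (ha : 0 < a) (hb : 0 < b) (x : ι → κ → ℝ) (y : μ → κ → ℝ)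
    (hx : ∀ i, ∑ k, x i k ^ 2 ≤ a ^ 2) (hy : ∀ j, ∑ k, y j k ^ 2 ≤ b ^ 2) :
    ∑ i, ∑ j, A i j * ∑ k, x i k * y j k ≤ K * (a * b) := by
  have h := hK κ (fun i k => x i k / a) (fun j k => y j k / b)
    (fun i => by
      simp only [div_pow, ← sum_div]
      exact (div_le_one (by positivity)).2 (hx i))
    (fun j => by
      simp only [div_pow, ← sum_div]
      exact (div_le_one (by positivity)).2 (hy j))
  rw [← div_le_iff₀ (by positivity)]
  refine le_trans (le_of_eq ?_) h
  rw [sum_div]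
  refine sum_congr rfl fun i _ => ?_
  rw [sum_div]
  refine sum_congr rfl fun j _ => ?_
  rw [mul_div_assoc, sum_div]
  congr 1
  refine sum_congr rfl fun k _ => ?_
  field_simp

/-- Inner products are averages of products of Rademacher sums. The truncated sums are bounded
scalars, to which `hB` applies pointwise; the tails are again vectors, of small norm, to which `hK`
applies. This bootstraps the bound. -/
lemma IsVectorBound.improve {A : ι → μ → ℝ} {K B : ℝ} (hK : IsVectorBound A K)
    (hB : ∀ (f : ι → ℝ) (h : μ → ℝ), (∀ i, |f i| ≤ 1) → (∀ j, |h j| ≤ 1) →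
      ∑ i, ∑ j, A i j * (f i * h j) ≤ B) :
    IsVectorBound A (49 * B + K / 2) := by
  classical
  intro κ _ x y hx hy
  -- Sums over sign patterns are not normalized, so an expectation is a sum divided by `N` and unit
  -- vectors acquire norm at most `√N`.
  set N : ℝ := (Fintype.card (κ → Bool) : ℝ) with hN
  have hNpos : 0 < N := by
    rw [hN]
    exact_mod_cast Fintype.card_pos
  set X : ι → (κ → Bool) → ℝ := fun i ω => ∑ k, boolSign (ω k) * x i k with hX
  set Y : μ → (κ → Bool) → ℝ := fun j ω => ∑ k, boolSign (ω k) * y j k with hY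
  set f : ι → (κ → Bool) → ℝ := fun i ω => truncate 7 (X i ω) with hf
  set h : μ → (κ → Bool) → ℝ := fun j ω => truncate 7 (Y j ω) with hh
  have hsN : √N ^ 2 = N := Real.sq_sqrt hNpos.le
  have hX2 : ∀ i, ∑ ω, X i ω ^ 2 ≤ √N ^ 2 := fun i => by
    have := sum_rademacher_mul (x i) (x i) univ
    simp only [← pow_two] at this
    rw [hsN, this]
    nlinarith [hx i]
  have hY2 : ∀ j, ∑ ω, Y j ω ^ 2 ≤ √N ^ 2 := fun j => by
    have := sum_rademacher_mul (y j) (y j) univ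
    simp only [← pow_two] at this
    rw [hsN, this]
    nlinarith [hy j]
  -- The fourth moment gives a tail of at most `3 / 49` of `N`, below `1 / 16`. Each of the two
  -- error terms thus costs `K / 4`.
  have tail : ∀ a : κ → ℝ, ∑ k, a k ^ 2 ≤ 1 →
      ∑ ω : κ → Bool, ((∑ k, boolSign (ω k) * a k) - truncate 7 (∑ k, boolSign (ω k) * a k)) ^ 2
        ≤ (√N / 4) ^ 2 := fun a ha => by
    have h4 := sum_rademacher_pow_four_le a univ
    have hs : (0 : ℝ) ≤ ∑ k, a k ^ 2 := sum_nonneg fun k _ => sq_nonneg _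
    have hle : 7 ^ 2 * ∑ ω : κ → Bool,
        ((∑ k, boolSign (ω k) * a k) - truncate 7 (∑ k, boolSign (ω k) * a k)) ^ 2
        ≤ ∑ ω : κ → Bool, (∑ k, boolSign (ω k) * a k) ^ 4 := by
      rw [mul_sum]
      exact sum_le_sum fun ω _ => sq_sub_truncate_le (by norm_num) _
    have h1 : (∑ k, a k ^ 2) ^ 2 ≤ 1 := by nlinarith
    rw [div_pow, hsN]
    nlinarith
  have hsum : ∀ u : ι → (κ → Bool) → ℝ, ∀ v : μ → (κ → Bool) → ℝ,
      ∑ i, ∑ j, A i j * ∑ ω, u i ω * v j ω = ∑ ω, ∑ i, ∑ j, A i j * (u i ω * v j ω) :=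
    fun u v => by
      simp only [mul_sum]
      rw [sum_comm (γ := κ → Bool)]
      exact sum_congr rfl fun i _ => sum_comm
  have t1 : ∑ i, ∑ j, A i j * ∑ ω, f i ω * h j ω ≤ N * (49 * B) := by
    rw [hsum]
    have : ∀ ω ∈ (univ : Finset (κ → Bool)),
        ∑ i, ∑ j, A i j * (f i ω * h j ω) ≤ 49 * B := fun ω _ => by
      have := hB (fun i => f i ω / 7) (fun j => h j ω / 7)
        (fun i => by
          rw [abs_div, abs_of_pos (by norm_num : (0 : ℝ) < 7), div_le_one (by norm_num)]
          exact abs_truncate_le (by norm_num) _)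
        (fun j => by
          rw [abs_div, abs_of_pos (by norm_num : (0 : ℝ) < 7), div_le_one (by norm_num)]
          exact abs_truncate_le (by norm_num) _)
      refine le_trans (le_of_eq ?_) (mul_le_mul_of_nonneg_left this (by norm_num : (0 : ℝ) ≤ 49))
      simp only [mul_sum]
      refine sum_congr rfl fun i _ => sum_congr rfl fun j _ => ?_
      ring
    refine (sum_le_card_nsmul _ _ _ this).trans_eq ?_
    rw [nsmul_eq_mul, card_univ]
  have t2 := hK.scale (a := √N / 4) (b := √N) (by positivity) (by positivity)
    (fun i ω => X i ω - f i ω) h (fun i => tail (x i) (hx i))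
    (fun j => (sum_le_sum fun ω _ => truncate_sq_le _ _).trans (hY2 j))
  have t3 := hK.scale (a := √N) (b := √N / 4) (by positivity) (by positivity)
    X (fun j ω => Y j ω - h j ω) hX2 (fun j => tail (y j) (hy j))
  have key : N * ∑ i, ∑ j, A i j * ∑ k, x i k * y j k
      = ∑ i, ∑ j, A i j * ∑ ω, f i ω * h j ω
        + ∑ i, ∑ j, A i j * ∑ ω, (X i ω - f i ω) * h j ω
        + ∑ i, ∑ j, A i j * ∑ ω, X i ω * (Y j ω - h j ω) := by
    rw [mul_sum, ← sum_add_distrib, ← sum_add_distrib]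
    refine sum_congr rfl fun i _ => ?_
    rw [mul_sum, ← sum_add_distrib, ← sum_add_distrib]
    refine sum_congr rfl fun j _ => ?_
    rw [← mul_add, ← mul_add, ← sum_add_distrib, ← sum_add_distrib, mul_left_comm,
      ← sum_rademacher_mul (x i) (y j) univ]
    congr 1
    refine sum_congr rfl fun ω _ => ?_
    change X i ω * Y j ω = _
    ring
  have e : √N / 4 * √N = N / 4 := by rw [div_mul_eq_mul_div, ← pow_two, hsN]
  have e' : √N * (√N / 4) = N / 4 := by rw [mul_comm, e]
  rw [e] at t2
  rw [e'] at t3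
  refine le_of_mul_le_mul_left ?_ hNpos
  rw [key]
  linarith

lemma abs_sum_mul_le_one {κ : Type*} [Fintype κ] (u v : κ → ℝ) (hu : ∑ k, u k ^ 2 ≤ 1)
    (hv : ∑ k, v k ^ 2 ≤ 1) : |∑ k, u k * v k| ≤ 1 := by
  have h := sum_mul_sq_le_sq_mul_sq univ u v
  have hu0 : 0 ≤ ∑ k, u k ^ 2 := sum_nonneg fun k _ => sq_nonneg _
  rw [← sq_le_one_iff_abs_le_one]
  exact h.trans (mul_le_one₀ hu (sum_nonneg fun k _ => sq_nonneg _) hv)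

/-- **Grothendieck's inequality**, with the constant `98`. -/
theorem isVectorBound_of_bilin_le {A : ι → μ → ℝ} {B : ℝ}
    (hB : ∀ (f : ι → ℝ) (h : μ → ℝ), (∀ i, |f i| ≤ 1) → (∀ j, |h j| ≤ 1) →
      ∑ i, ∑ j, A i j * (f i * h j) ≤ B) :
    IsVectorBound A (98 * B) := by
  let S : Set ℝ := {t | ∃ (κ : Type) (_ : Fintype κ) (x : ι → κ → ℝ) (y : μ → κ → ℝ),
    (∀ i, ∑ k, x i k ^ 2 ≤ 1) ∧ (∀ j, ∑ k, y j k ^ 2 ≤ 1) ∧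
      t = ∑ i, ∑ j, A i j * ∑ k, x i k * y j k}
  -- Finiteness of the supremum `K` is what lets `K ≤ 49 * B + K / 2` be solved for `K`.
  have hbdd : BddAbove S := by
    refine ⟨∑ i, ∑ j, |A i j|, ?_⟩
    rintro t ⟨κ, _, x, y, hx, hy, rfl⟩
    refine sum_le_sum fun i _ => sum_le_sum fun j _ => (le_abs_self _).trans ?_
    rw [abs_mul]
    exact mul_le_of_le_one_right (abs_nonneg _) (abs_sum_mul_le_one _ _ (hx i) (hy j))
  have hne : S.Nonempty := ⟨_, Empty, inferInstance, fun _ _ => 0, fun _ _ => 0, by simp, by simp,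
    rfl⟩
  have hK : IsVectorBound A (sSup S) := fun κ _ x y hx hy =>
    le_csSup hbdd ⟨κ, _, x, y, hx, hy, rfl⟩
  have himp := hK.improve hB
  have : sSup S ≤ 49 * B + sSup S / 2 := csSup_le hne <| by
    rintro t ⟨κ, _, x, y, hx, hy, rfl⟩
    exact himp κ x y hx hy
  intro κ _ x y hx hy
  linarith [hK κ x y hx hy]

end Grothendieck

/-! ### Testing against singular vectors -/

section Spectral

open Matrix

variable {ι μ : Type*} [Fintype ι] [Fintype μ]

/-- Cauchy–Schwarz twice: `Q² ≤ P * R` and `P² ≤ #s * Q` for the power sums `P`, `Q`, `R` of orders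
1, 2, 3; then cancel `Q`. -/
lemma sum_sq_pow_three_le {κ : Type*} [Fintype κ] (s : Finset κ) (σ : κ → ℝ) (hσ : ∀ k, 0 ≤ σ k) :
    (∑ k ∈ s, σ k ^ 2) ^ 3 ≤ #s * (∑ k ∈ s, σ k ^ 3) ^ 2 := by
  set P := ∑ k ∈ s, σ k with hP
  set Q := ∑ k ∈ s, σ k ^ 2 with hQ
  set R := ∑ k ∈ s, σ k ^ 3 with hR
  have hQ0 : 0 ≤ Q := sum_nonneg fun k _ => sq_nonneg _
  have h1 : Q ^ 2 ≤ P * R := by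
    refine sum_sq_le_sum_mul_sum_of_sq_le_mul s (fun k _ => hσ k) (fun k _ => pow_nonneg (hσ k) 3)
      fun k _ => le_of_eq (by ring)
  have h2 : P ^ 2 ≤ #s * Q := sq_sum_le_card_mul_sum_sq
  rcases hQ0.eq_or_lt with h | h
  · rw [← h]
    simp only [ne_eq, OfNat.ofNat_ne_zero, not_false_eq_true, zero_pow]
    positivity
  · have h3 : Q * Q ^ 3 ≤ Q * (#s * R ^ 2) := by
      calc Q * Q ^ 3 = (Q ^ 2) ^ 2 := by ring
        _ ≤ (P * R) ^ 2 := pow_le_pow_left₀ (sq_nonneg _) h1 2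
        _ = P ^ 2 * R ^ 2 := by ring
        _ ≤ #s * Q * R ^ 2 := mul_le_mul_of_nonneg_right h2 (sq_nonneg _)
        _ = Q * (#s * R ^ 2) := by ring
    exact le_of_mul_le_mul_left h3 h

lemma exists_spectral_decomposition [DecidableEq ι] (A : Matrix ι μ ℝ) :
    ∃ (W : Matrix ι ι ℝ) (l : ι → ℝ), (∀ k, 0 ≤ l k) ∧ W * Wᵀ = 1 ∧ Wᵀ * W = 1 ∧
      A * Aᵀ = W * diagonal l * Wᵀ ∧ #(univ.filter fun k => l k ≠ 0) = A.rank := by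
  have hpos : (A * Aᵀ).PosSemidef := by
    simpa using posSemidef_self_mul_conjTranspose A
  have hA := hpos.isHermitian
  have hu := hA.eigenvectorUnitary.2
  rw [mem_unitaryGroup_iff] at hu
  have hu' : (hA.eigenvectorUnitary : Matrix ι ι ℝ) * (hA.eigenvectorUnitary : Matrix ι ι ℝ)ᵀ = 1 :=
    by simpa [star_eq_conjTranspose] using hu
  refine ⟨hA.eigenvectorUnitary, hA.eigenvalues, hpos.eigenvalues_nonneg, hu',
    mul_eq_one_comm.1 hu', ?_, ?_⟩
  · conv_lhs => rw [hA.spectral_theorem]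
    simp [Unitary.conjStarAlgAut_apply, star_eq_conjTranspose]
  · rw [← rank_self_mul_transpose, hA.rank_eq_card_non_zero_eigs, Fintype.card_subtype]

/-- If `K` bounds the bilinear form of `A` on unit vectors, the rows of `A` have norm at most `a`
and its columns norm at most `b`, then `‖A‖_F ^ 3 ≤ √(rank A) * K * a * b`. -/
theorem IsVectorBound.sum_sq_pow_three_le {ι μ : Type} [Fintype ι] [Fintype μ]
    {A : Matrix ι μ ℝ} {K a b : ℝ} (hK : IsVectorBound A K)
    (ha : 0 < a) (hb : 0 < b) (hrow : ∀ i, ∑ j, A i j ^ 2 ≤ a ^ 2)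
    (hcol : ∀ j, ∑ i, A i j ^ 2 ≤ b ^ 2) :
    (∑ i, ∑ j, A i j ^ 2) ^ 3 ≤ A.rank * (K * (a * b)) ^ 2 := by
  classical
  obtain ⟨W, l, hl, hW, hW', hB, hcard⟩ := exists_spectral_decomposition A
  have hBe : ∀ i i', ∑ j, A i j * A i' j = ∑ k, l k * (W i k * W i' k) := fun i i' => by
    have := congrFun (congrFun hB i) i'
    rw [mul_apply, mul_apply] at this
    simp only [transpose_apply, mul_diagonal] at this
    rw [this]
    exact sum_congr rfl fun k _ => by ring
  have hWk : ∀ k, ∑ i, W i k ^ 2 = 1 := fun k => by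
    have := congrFun (congrFun hW' k) k
    rw [mul_apply, one_apply_eq] at this
    rw [← this]
    exact sum_congr rfl fun i _ => by rw [transpose_apply, pow_two]
  set y : μ → ι → ℝ := fun j k => (Wᵀ * A) k j with hy
  have hyB : ∀ k, ∑ j, y j k ^ 2 = l k := fun k => by
    have : Wᵀ * A * (Wᵀ * A)ᵀ = diagonal l := by
      rw [transpose_mul, transpose_transpose, Matrix.mul_assoc, ← Matrix.mul_assoc A, hB]
      simp only [Matrix.mul_assoc, hW', Matrix.mul_one]
      rw [← Matrix.mul_assoc, hW', Matrix.one_mul]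
    have := congrFun (congrFun this k) k
    rw [mul_apply, diagonal_apply_eq] at this
    rw [← this]
    exact sum_congr rfl fun j _ => by rw [transpose_apply, pow_two]
  have hyc : ∀ j, ∑ k, y j k ^ 2 = ∑ i, A i j ^ 2 := fun j => by
    have : (Wᵀ * A)ᵀ * (Wᵀ * A) = Aᵀ * A := by
      rw [transpose_mul, transpose_transpose, Matrix.mul_assoc, ← Matrix.mul_assoc W, hW,
        Matrix.one_mul]
    have := congrFun (congrFun this j) j
    rw [mul_apply, mul_apply] at this
    simpa only [transpose_apply, pow_two] using this
  -- With `√(l k)` the singular values and `W` the left singular vectors, both families are singular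
  -- vectors weighted by singular values; their squared norms are the row and column sums of
  -- squares.
  have h := hK.scale ha hb (fun i k => √(l k) * W i k) y
    (fun i => by
      refine le_trans (le_of_eq ?_) (hrow i)
      simp only [pow_two (A _ _), hBe, mul_pow, Real.sq_sqrt (hl _)]
      simp only [pow_two])
    (fun j => (hyc j).trans_le (hcol j))
  have hform : ∑ i, ∑ j, A i j * ∑ k, √(l k) * W i k * y j k = ∑ k, √(l k) ^ 3 := by
    calc ∑ i, ∑ j, A i j * ∑ k, √(l k) * W i k * y j k
        = ∑ k, ∑ j, ∑ i, √(l k) * y j k * (W i k * A i j) := by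
          simp only [mul_sum]
          refine sum_comm.trans ((sum_congr rfl fun j _ => sum_comm).trans (sum_comm.trans ?_))
          exact sum_congr rfl fun k _ => sum_congr rfl fun j _ => sum_congr rfl fun i _ => by ring
      _ = ∑ k, √(l k) * ∑ j, y j k ^ 2 := by
          refine sum_congr rfl fun k _ => ?_
          rw [mul_sum]
          refine sum_congr rfl fun j _ => ?_
          rw [← mul_sum]
          have : ∑ i, W i k * A i j = y j k := by
            simp only [hy, mul_apply, transpose_apply]
          rw [this]
          ring
      _ = ∑ k, √(l k) ^ 3 := by
          refine sum_congr rfl fun k _ => ?_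
          rw [hyB]
          conv_lhs => rw [← Real.sq_sqrt (hl k)]
          rw [Real.sqrt_sq (Real.sqrt_nonneg _)]
          ring
  rw [hform] at h
  have hF : ∑ i, ∑ j, A i j ^ 2 = ∑ k, √(l k) ^ 2 := by
    simp only [pow_two (A _ _), hBe]
    rw [sum_comm]
    refine sum_congr rfl fun k _ => ?_
    rw [← mul_sum, Real.sq_sqrt (hl k)]
    simp only [← pow_two, hWk, mul_one]
  -- Dropping zero singular values makes the cardinality in Hölder's inequality equal to the rank.
  have hsupp : ∀ e : ℕ, e ≠ 0 → ∑ k ∈ univ.filter (fun k => l k ≠ 0), √(l k) ^ e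
      = ∑ k, √(l k) ^ e := fun e he => by
    refine sum_filter_of_ne fun k _ hk => ?_
    rintro h0
    exact hk (by rw [h0, Real.sqrt_zero, zero_pow he])
  have hmain := MatrixDisc.sum_sq_pow_three_le (univ.filter fun k => l k ≠ 0) (fun k => √(l k))
    fun k => Real.sqrt_nonneg _
  rw [hsupp 2 two_ne_zero, hsupp 3 three_ne_zero, hcard, ← hF] at hmain
  refine hmain.trans (mul_le_mul_of_nonneg_left ?_ (Nat.cast_nonneg _))
  exact pow_le_pow_left₀ (sum_nonneg fun k _ => pow_nonneg (Real.sqrt_nonneg _) 3) h 2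

end Spectral

/-! ### Discrepancy as the cut norm of the centered matrix -/

section Basic

variable {m n : ℕ} {M : Matrix (Fin m) (Fin n) ℝ}

lemma IsBinary.nonneg (hM : IsBinary M) (i : Fin m) (j : Fin n) : 0 ≤ M i j := by
  rcases hM i j with h | h <;> simp [h]

lemma IsBinary.onesIn_eq (hM : IsBinary M) (X : Finset (Fin m)) (Y : Finset (Fin n)) :
    (onesIn M X Y : ℝ) = ∑ i ∈ X, ∑ j ∈ Y, M i j := by
  classical
  rw [onesIn, card_filter, Nat.cast_sum, sum_product]
  refine sum_congr rfl fun i _ => sum_congr rfl fun j _ => ?_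
  rcases hM i j with h | h <;> simp [h]

lemma density_nonneg : 0 ≤ density M := by
  unfold density
  positivity

lemma IsBinary.sum_eq (hM : IsBinary M) (hm : 0 < m) (hn : 0 < n) :
    ∑ i, ∑ j, M i j = density M * (m * n) := by
  rw [density, hM.onesIn_eq]
  field_simp

lemma IsBinary.abs_le_disc (hM : IsBinary M) (X : Finset (Fin m)) (Y : Finset (Fin n)) :
    |∑ i ∈ X, ∑ j ∈ Y, (M i j - density M)| ≤ disc M := by
  have h := le_sup' (fun P : Finset (Fin m) × Finset (Fin n) =>
    |(onesIn M P.1 P.2 : ℝ) - density M * (P.1.card : ℝ) * (P.2.card : ℝ)|) (mem_univ (X, Y))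
  refine le_trans (le_of_eq ?_) h
  simp only [hM.onesIn_eq, sum_sub_distrib, sum_const, nsmul_eq_mul]
  ring_nf

lemma IsBinary.disc_le (hM : IsBinary M) {D : ℝ}
    (h : ∀ (X : Finset (Fin m)) (Y : Finset (Fin n)),
      |∑ i ∈ X, ∑ j ∈ Y, (M i j - density M)| ≤ D) : disc M ≤ D := by
  refine sup'_le _ _ fun P _ => ?_
  refine le_trans (le_of_eq ?_) (h P.1 P.2)
  simp only [hM.onesIn_eq, sum_sub_distrib, sum_const, nsmul_eq_mul]
  ring_nf

lemma IsBinary.disc_nonneg (hM : IsBinary M) : 0 ≤ disc M :=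
  (abs_nonneg _).trans (hM.abs_le_disc ∅ ∅)

end Basic

/-! ### The lower bound -/

section LowerBound

open Matrix

variable {m n : ℕ} {M : Matrix (Fin m) (Fin n) ℝ}

lemma rank_add_le_rank_add_rank {ι μ : Type*} [Fintype μ] [Finite ι] (A B : Matrix ι μ ℝ) :
    (A + B).rank ≤ A.rank + B.rank := by
  rw [Matrix.rank, Matrix.rank, Matrix.rank, mulVecLin_add]
  refine (Submodule.finrank_mono ?_).trans (Submodule.finrank_add_le_finrank_add_finrank _ _)
  rintro _ ⟨v, rfl⟩
  exact Submodule.add_mem_sup ⟨v, rfl⟩ ⟨v, rfl⟩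

/-- The part of `M - density M` on the rectangle `X × Y`, extended by zero. -/
noncomputable def centeredOn (M : Matrix (Fin m) (Fin n) ℝ) (X : Finset (Fin m))
    (Y : Finset (Fin n)) : Matrix (Fin m) (Fin n) ℝ :=
  fun i j => if i ∈ X ∧ j ∈ Y then M i j - density M else 0

lemma sum_centeredOn (φ : ℝ → ℝ) (hφ : φ 0 = 0) (X X' : Finset (Fin m)) (Y Y' : Finset (Fin n)) :
    ∑ i ∈ X', ∑ j ∈ Y', φ (centeredOn M X Y i j)
      = ∑ i ∈ X' ∩ X, ∑ j ∈ Y' ∩ Y, φ (M i j - density M) := by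
  simp only [← filter_mem_eq_inter, sum_filter]
  refine sum_congr rfl fun i _ => ?_
  by_cases hi : i ∈ X
  · rw [if_pos hi]
    refine sum_congr rfl fun j _ => ?_
    by_cases hj : j ∈ Y <;> simp [centeredOn, hi, hj, hφ]
  · rw [if_neg hi]
    exact sum_eq_zero fun j _ => by simp [centeredOn, hi, hφ]

/-- Centering is a rank-one perturbation, and restriction to a rectangle is multiplication by
diagonal matrices. -/
lemma rank_centeredOn_le (X : Finset (Fin m)) (Y : Finset (Fin n)) :
    (centeredOn M X Y).rank ≤ M.rank + 1 := by
  have e : centeredOn M X Y = diagonal (fun i => if i ∈ X then (1 : ℝ) else 0) *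
      (M + vecMulVec (fun _ => -density M) (fun _ => 1)) *
      diagonal (fun j => if j ∈ Y then (1 : ℝ) else 0) := by
    ext i j
    rw [mul_diagonal, diagonal_mul]
    by_cases hi : i ∈ X <;> by_cases hj : j ∈ Y <;>
      simp [centeredOn, hi, hj, vecMulVec_apply, sub_eq_add_neg]
  rw [e]
  refine (rank_mul_le_left _ _).trans ((rank_mul_le_right _ _).trans ((rank_add_le_rank_add_rank _ _).trans ?_))
  exact Nat.add_le_add_left (rank_vecMulVec_le _ _) _

lemma IsBinary.isVectorBound_centeredOn (hM : IsBinary M) (X : Finset (Fin m))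
    (Y : Finset (Fin n)) : IsVectorBound (centeredOn M X Y) (98 * (4 * disc M)) := by
  refine isVectorBound_of_bilin_le fun f h hf hh =>
    bilin_le_four_mul_of_abs_cut_le _ (fun X' Y' => ?_) f h hf hh
  have := sum_centeredOn (M := M) id rfl X X' Y Y'
  simp only [id] at this
  rw [this]
  exact hM.abs_le_disc _ _

/-- Rows of more than twice the average weight carry few ones. -/
lemma IsBinary.sum_heavy_rows_le (hM : IsBinary M) :
    ∑ i ∈ univ.filter (fun i => ¬ ∑ j, M i j ≤ 2 * density M * n), ∑ j, M i j ≤ 2 * disc M := by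
  have h := (le_abs_self _).trans
    (hM.abs_le_disc (univ.filter fun i => ¬ ∑ j, M i j ≤ 2 * density M * n) univ)
  refine le_trans ?_ (mul_le_mul_of_nonneg_left h zero_le_two)
  rw [mul_sum]
  refine sum_le_sum fun i hi => ?_
  rw [mem_filter, not_le] at hi
  simp only [sum_sub_distrib, sum_const, card_univ, Fintype.card_fin, nsmul_eq_mul]
  linarith [hi.2]

lemma IsBinary.sum_heavy_cols_le (hM : IsBinary M) :
    ∑ j ∈ univ.filter (fun j => ¬ ∑ i, M i j ≤ 2 * density M * m), ∑ i, M i j ≤ 2 * disc M := by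
  have h := (le_abs_self _).trans
    (hM.abs_le_disc univ (univ.filter fun j => ¬ ∑ i, M i j ≤ 2 * density M * m))
  refine le_trans ?_ (mul_le_mul_of_nonneg_left h zero_le_two)
  rw [show ∑ i, ∑ j ∈ univ.filter (fun j => ¬ ∑ i, M i j ≤ 2 * density M * m),
    (M i j - density M) = _ from sum_comm, mul_sum]
  refine sum_le_sum fun i hi => ?_
  rw [mem_filter, not_le] at hi
  simp only [sum_sub_distrib, sum_const, card_univ, Fintype.card_fin, nsmul_eq_mul]
  linarith [hi.2]

lemma IsBinary.sq_sub_density_le (hM : IsBinary M) (i : Fin m) (j : Fin n) :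
    (M i j - density M) ^ 2 ≤ M i j + density M ^ 2 := by
  have := density_nonneg (M := M)
  rcases hM i j with h | h <;> rw [h] <;> nlinarith

lemma IsBinary.le_sq_sub_density (hM : IsBinary M) (hp : density M ≤ 1 / 2) (i : Fin m)
    (j : Fin n) : M i j / 4 ≤ (M i j - density M) ^ 2 := by
  have := density_nonneg (M := M)
  rcases hM i j with h | h <;> rw [h] <;> nlinarith

/-- If the discrepancy is small compared to the number of ones, then discarding the heavy rows and
columns and testing against the singular vectors bounds it from below. -/
lemma IsBinary.spectral_bound (hM : IsBinary M) (hm : 0 < m) (hn : 0 < n)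
    (hp : density M ≤ 1 / 2) (hp0 : 0 < density M)
    (hD : disc M ≤ density M * (m * n) / 16) :
    (density M * (m * n) / 8) ^ 3
      ≤ (M.rank + 1) * ((98 * (4 * disc M)) ^ 2 * (9 * density M ^ 2 * (m * n))) := by
  set p := density M with hpdef
  have hm' : (0 : ℝ) < m := Nat.cast_pos.2 hm
  have hn' : (0 : ℝ) < n := Nat.cast_pos.2 hn
  set X := univ.filter fun i => ∑ j, M i j ≤ 2 * p * n with hX
  set Y := univ.filter fun j => ∑ i, M i j ≤ 2 * p * m with hY
  have hheavyR := hM.sum_heavy_rows_le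
  have hheavyC := hM.sum_heavy_cols_le
  have hsum := hM.sum_eq hm hn
  rw [← hpdef] at hheavyR hheavyC hsum
  -- Heavy rows and heavy columns each carry at most `2 * disc M ≤ p * (m * n) / 8` ones.
  have hones : 3 / 4 * (p * (m * n)) ≤ ∑ i ∈ X, ∑ j ∈ Y, M i j := by
    have h1 := sum_filter_add_sum_filter_not univ (fun i => ∑ j, M i j ≤ 2 * p * n)
      fun i => ∑ j, M i j
    rw [hsum] at h1
    have h2 : ∑ i ∈ X, ∑ j, M i j
        = ∑ i ∈ X, ∑ j ∈ Y, M i j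
          + ∑ i ∈ X, ∑ j ∈ univ.filter (fun j => ¬ ∑ i, M i j ≤ 2 * p * m), M i j := by
      rw [← sum_add_distrib]
      exact sum_congr rfl fun i _ =>
        (sum_filter_add_sum_filter_not univ (fun j => ∑ i, M i j ≤ 2 * p * m) _).symm
    have h3 : ∑ i ∈ X, ∑ j ∈ univ.filter (fun j => ¬ ∑ i, M i j ≤ 2 * p * m), M i j
        ≤ 2 * disc M := by
      refine sum_comm.trans_le (le_trans (sum_le_sum fun j _ => ?_) hheavyC)
      exact sum_le_sum_of_subset_of_nonneg (subset_univ _) fun i _ _ => hM.nonneg i j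
    rw [← hX] at h1
    linarith
  have hrow : ∀ i, ∑ j, centeredOn M X Y i j ^ 2 ≤ √(3 * p * n) ^ 2 := fun i => by
    rw [Real.sq_sqrt (by positivity)]
    by_cases hi : i ∈ X
    · calc ∑ j, centeredOn M X Y i j ^ 2 ≤ ∑ j, (M i j + p ^ 2) := by
            refine sum_le_sum fun j _ => ?_
            by_cases hj : j ∈ Y
            · simpa [centeredOn, hi, hj] using hM.sq_sub_density_le i j
            · simp only [centeredOn, hj, and_false, if_false]
              nlinarith [hM.nonneg i j, sq_nonneg p]
        _ = ∑ j, M i j + n * p ^ 2 := by simp [sum_add_distrib]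
        _ ≤ 3 * p * n := by
            have := (mem_filter.1 hi).2
            nlinarith [mul_pos hp0 hn']
    · simp only [centeredOn, hi, false_and, if_false]
      simp only [ne_eq, OfNat.ofNat_ne_zero, not_false_eq_true, zero_pow, sum_const_zero]
      positivity
  have hcol : ∀ j, ∑ i, centeredOn M X Y i j ^ 2 ≤ √(3 * p * m) ^ 2 := fun j => by
    rw [Real.sq_sqrt (by positivity)]
    by_cases hj : j ∈ Y
    · calc ∑ i, centeredOn M X Y i j ^ 2 ≤ ∑ i, (M i j + p ^ 2) := by
            refine sum_le_sum fun i _ => ?_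
            by_cases hi : i ∈ X
            · simpa [centeredOn, hi, hj] using hM.sq_sub_density_le i j
            · simp only [centeredOn, hi, false_and, if_false]
              nlinarith [hM.nonneg i j, sq_nonneg p]
        _ = ∑ i, M i j + m * p ^ 2 := by simp [sum_add_distrib]
        _ ≤ 3 * p * m := by
            have := (mem_filter.1 hj).2
            nlinarith [mul_pos hp0 hm']
    · simp only [centeredOn, hj, and_false, if_false]
      simp only [ne_eq, OfNat.ofNat_ne_zero, not_false_eq_true, zero_pow, sum_const_zero]
      positivity
  have hfrob : p * (m * n) / 8 ≤ ∑ i, ∑ j, centeredOn M X Y i j ^ 2 := by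
    rw [sum_centeredOn (M := M) (fun t => t ^ 2) (by simp) X univ Y univ, univ_inter, univ_inter]
    have : (∑ i ∈ X, ∑ j ∈ Y, M i j) / 4 ≤ ∑ i ∈ X, ∑ j ∈ Y, (M i j - density M) ^ 2 := by
      rw [sum_div]
      refine sum_le_sum fun i _ => ?_
      rw [sum_div]
      exact sum_le_sum fun j _ => hM.le_sq_sub_density hp i j
    have h0 : 0 < p * (m * n) := by positivity
    linarith
  have h := (hM.isVectorBound_centeredOn X Y).sum_sq_pow_three_le
    (Real.sqrt_pos.2 (by positivity : 0 < 3 * p * n)) (Real.sqrt_pos.2 (by positivity : 0 < 3 * p * m))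
    hrow hcol
  have e : (98 * (4 * disc M) * (√(3 * p * n) * √(3 * p * m))) ^ 2
      = (98 * (4 * disc M)) ^ 2 * (9 * p ^ 2 * (m * n)) := by
    rw [mul_pow, mul_pow (√(3 * p * n)), Real.sq_sqrt (by positivity), Real.sq_sqrt (by positivity)]
    ring
  rw [e] at h
  refine (pow_le_pow_left₀ (by positivity) hfrob 3).trans (h.trans ?_)
  refine mul_le_mul_of_nonneg_right ?_ (by positivity)
  exact_mod_cast rank_centeredOn_le X Y

/-- The discrepancy of a binary matrix of rank at most `r` and density `p ≤ 1 / 2` is at least of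
order `m * n * min p (√p / √r)`. -/
theorem IsBinary.le_disc (hM : IsBinary M) (hm : 0 < m) (hn : 0 < n) {r : ℕ} (hr : 0 < r)
    (hrank : M.rank ≤ r) (hp : density M ≤ 1 / 2) :
    1 / 40000 * ((m : ℝ) * n) * min (density M) (√(density M) / √r) ≤ disc M := by
  set p := density M with hpdef
  have hm' : (0 : ℝ) < m := Nat.cast_pos.2 hm
  have hn' : (0 : ℝ) < n := Nat.cast_pos.2 hn
  have hr' : (0 : ℝ) < r := Nat.cast_pos.2 hr
  have hmn : (0 : ℝ) < m * n := by positivity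
  have hp0 : 0 ≤ p := density_nonneg
  rcases le_total (p * (m * n) / 16) (disc M) with hD | hD
  · refine le_trans ?_ hD
    have : (m : ℝ) * n * min p (√p / √r) ≤ m * n * p :=
      mul_le_mul_of_nonneg_left (min_le_left _ _) hmn.le
    nlinarith
  · rcases hp0.eq_or_lt with h0 | h0
    · have : min p (√p / √r) = 0 := by
        rw [← h0]
        simp
      rw [this, mul_zero]
      exact hM.disc_nonneg
    have h := hM.spectral_bound hm hn hp h0 hD
    rw [← hpdef] at h
    have hrank' : (M.rank : ℝ) + 1 ≤ 2 * r := by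
      have h1 : (M.rank : ℝ) ≤ r := by exact_mod_cast hrank
      have h2 : (1 : ℝ) ≤ r := by exact_mod_cast hr
      linarith
    have hDn := hM.disc_nonneg
    have h1 : (p * (m * n) / 8) ^ 3
        ≤ 2 * r * ((98 * (4 * disc M)) ^ 2 * (9 * p ^ 2 * (m * n))) :=
      h.trans (mul_le_mul_of_nonneg_right hrank' (by positivity))
    -- The constant fits because `8³ * 2 * 9 * 392² < 40000²`, where `392 = 98 * 4`.
    have h2 : (p ^ 2 * (m * n)) * (p * (m * n) ^ 2)
        ≤ (p ^ 2 * (m * n)) * (r * (40000 * disc M) ^ 2) := by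
      have : 0 ≤ r * disc M ^ 2 * (p ^ 2 * (m * n)) := by positivity
      nlinarith
    have h3 := le_of_mul_le_mul_left h2 (by positivity)
    have h4 : (m * n * (√p / √r)) ^ 2 ≤ (40000 * disc M) ^ 2 := by
      rw [mul_pow, div_pow, Real.sq_sqrt hp0, Real.sq_sqrt hr'.le, mul_div_assoc',
        div_le_iff₀ hr']
      linarith
    have h5 := le_of_sq_le_sq h4 (by positivity)
    have h6 : (m : ℝ) * n * min p (√p / √r) ≤ m * n * (√p / √r) :=
      mul_le_mul_of_nonneg_left (min_le_right _ _) hmn.le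
    linarith

end LowerBound

/-! ### Random Bernoulli matrices by exponential moments -/

section RandomMatrix

/-- The probability of a Boolean under the Bernoulli distribution with parameter `q`. -/
def bernoulliWeight (q : ℝ) (b : Bool) : ℝ := if b then q else 1 - q

/-- A Boolean as a real number. -/
def boolVal (b : Bool) : ℝ := if b then 1 else 0

/-- Combines `exp s ≤ 1 + s + s²` for `|s| ≤ 1` with `1 + x ≤ exp x`; the linear term cancels
against the centering. -/
lemma bernoulli_mgf_le {q s : ℝ} (hq : 0 ≤ q) (hs : |s| ≤ 1) :
    ∑ b, bernoulliWeight q b * Real.exp (s * (boolVal b - q)) ≤ Real.exp (q * s ^ 2) := by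
  have h1 : Real.exp s ≤ 1 + s + s ^ 2 := by
    have := (abs_le.1 (Real.abs_exp_sub_one_sub_id_le hs)).2
    linarith
  have e : ∑ b, bernoulliWeight q b * Real.exp (s * (boolVal b - q))
      = Real.exp (-(s * q)) * (q * (Real.exp s - 1) + 1) := by
    simp only [Fintype.sum_bool, bernoulliWeight, boolVal, if_true, Bool.false_eq_true, if_false]
    rw [show s * (1 - q) = -(s * q) + s by ring, Real.exp_add,
      show s * (0 - q) = -(s * q) by ring]
    ring
  rw [e]
  calc Real.exp (-(s * q)) * (q * (Real.exp s - 1) + 1)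
      ≤ Real.exp (-(s * q)) * Real.exp (q * (s + s ^ 2)) := by
        refine mul_le_mul_of_nonneg_left ?_ (Real.exp_pos _).le
        refine le_trans ?_ (Real.add_one_le_exp _)
        nlinarith
    _ = Real.exp (q * s ^ 2) := by
        rw [← Real.exp_add]
        ring_nf

lemma product_bernoulli_mgf_le {ι : Type*} [Fintype ι] [DecidableEq ι] {q : ℝ} (hq : 0 ≤ q)
    (hq1 : q ≤ 1) (s : ι → ℝ) (hs : ∀ e, |s e| ≤ 1) :
    ∑ ω : ι → Bool, (∏ e, bernoulliWeight q (ω e)) * Real.exp (∑ e, s e * (boolVal (ω e) - q))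
      ≤ Real.exp (∑ e, q * s e ^ 2) := by
  have hw : ∀ b, 0 ≤ bernoulliWeight q b := fun b => by
    cases b <;> simp [bernoulliWeight, hq, hq1]
  rw [Real.exp_sum]
  calc _ = ∏ e, ∑ b, bernoulliWeight q b * Real.exp (s e * (boolVal b - q)) := by
        rw [prod_univ_sum, Fintype.piFinset_univ]
        refine sum_congr rfl fun ω _ => ?_
        rw [Real.exp_sum, ← prod_mul_distrib]
    _ ≤ _ := prod_le_prod
        (fun e _ => sum_nonneg fun b _ => mul_nonneg (hw b) (Real.exp_pos _).le)
        fun e _ => bernoulli_mgf_le hq (hs e)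

lemma sum_prod_bernoulliWeight {ι : Type*} [Fintype ι] [DecidableEq ι] (q : ℝ) :
    ∑ ω : ι → Bool, ∏ e, bernoulliWeight q (ω e) = 1 := by
  have := prod_univ_sum (fun _ : ι => (univ : Finset Bool)) fun _ b => bernoulliWeight q b
  rw [Fintype.piFinset_univ] at this
  rw [← this]
  simp [bernoulliWeight]

lemma two_mul_four_pow_le_exp {r : ℕ} (hr : 0 < r) :
    (2 : ℝ) * 4 ^ r ≤ Real.exp (3 * r) := by
  have h2 : (2 : ℝ) ≤ Real.exp 1 := by
    have := Real.add_one_le_exp (1 : ℝ)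
    linarith
  have h1 : (1 : ℝ) ≤ r := by exact_mod_cast hr
  calc (2 : ℝ) * 4 ^ r = 2 ^ (1 + 2 * r) := by
        rw [pow_add, pow_mul]
        norm_num
    _ ≤ Real.exp 1 ^ (1 + 2 * r) := pow_le_pow_left₀ (by norm_num) h2 _
    _ = Real.exp (1 + 2 * r) := by
        rw [← Real.exp_nat_mul]
        push_cast
        ring_nf
    _ ≤ Real.exp (3 * r) := Real.exp_le_exp.2 (by linarith)

/-- There is an `r × r` binary matrix whose entries deviate little from `q` on every rectangle. -/
theorem exists_binary_cut_le {r : ℕ} (hr : 0 < r) {q : ℝ} (hq1 : q ≤ 1) (hqr : 1 ≤ q * r) :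
    ∃ Q : Fin r → Fin r → ℝ, (∀ a b, Q a b = 0 ∨ Q a b = 1) ∧
      ∀ X Y : Finset (Fin r), |∑ a ∈ X, ∑ b ∈ Y, (Q a b - q)| ≤ 4 * r * √(q * r) := by
  have hr' : (0 : ℝ) < r := Nat.cast_pos.2 hr
  have hq : 0 < q := pos_of_mul_pos_left (by linarith) hr'.le
  set t := √(q * r) with ht
  have ht2 : t ^ 2 = q * r := Real.sq_sqrt (by positivity)
  have ht1 : 1 ≤ t := Real.one_le_sqrt.2 hqr
  -- One test vector per rectangle and sign. The scale `1 / t` makes the total exponent `q * r² / t²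
  -- = r`, comparable to the logarithm of the `2 * 4 ^ r` tests; `1 ≤ q * r` keeps it at most 1.
  let σ : Finset (Fin r) × Finset (Fin r) × Bool → Fin r × Fin r → ℝ := fun T e =>
    if e ∈ T.1 ×ˢ T.2.1 then boolSign T.2.2 / t else 0
  have hσ : ∀ T e, σ T e ^ 2 ≤ (1 / t) ^ 2 := fun T e => by
    simp only [σ]
    split_ifs
    · rw [div_pow, boolSign_sq, div_pow, one_pow]
    · simp only [ne_eq, OfNat.ofNat_ne_zero, not_false_eq_true, zero_pow]
      positivity
  have ht' : (1 / t) ^ 2 ≤ 1 := pow_le_one₀ (by positivity) ((div_le_one (by linarith)).2 ht1)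
  have hmgf : ∀ T, ∑ ω : Fin r × Fin r → Bool, (∏ e, bernoulliWeight q (ω e)) *
      Real.exp (∑ e, σ T e * (boolVal (ω e) - q)) ≤ Real.exp r := fun T => by
    refine (product_bernoulli_mgf_le hq.le hq1 (σ T) fun e =>
      (sq_le_one_iff_abs_le_one _).1 ((hσ T e).trans ht')).trans (Real.exp_le_exp.2 ?_)
    calc ∑ e, q * σ T e ^ 2 ≤ ∑ _e : Fin r × Fin r, q * (1 / t) ^ 2 :=
          sum_le_sum fun e _ => mul_le_mul_of_nonneg_left (hσ T e) hq.le
      _ = r := by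
          simp only [sum_const, card_univ, Fintype.card_prod, Fintype.card_fin, nsmul_eq_mul,
            Nat.cast_mul]
          rw [div_pow, ht2]
          field_simp
  have hcard : (Fintype.card (Finset (Fin r) × Finset (Fin r) × Bool) : ℝ) = 2 * 4 ^ r := by
    simp only [Fintype.card_prod, Fintype.card_finset, Fintype.card_fin, Fintype.card_bool]
    push_cast
    rw [show (4 : ℝ) = 2 * 2 by norm_num, mul_pow]
    ring
  have htotal : ∑ ω : Fin r × Fin r → Bool, (∏ e, bernoulliWeight q (ω e)) *
      ∑ T, Real.exp (∑ e, σ T e * (boolVal (ω e) - q))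
      ≤ ∑ ω : Fin r × Fin r → Bool, (∏ e, bernoulliWeight q (ω e)) * Real.exp (3 * r + r) := by
    rw [← sum_mul, sum_prod_bernoulliWeight, one_mul]
    simp only [mul_sum]
    rw [sum_comm]
    refine (sum_le_card_nsmul _ _ _ fun T _ => hmgf T).trans ?_
    rw [nsmul_eq_mul, card_univ, hcard, Real.exp_add]
    exact mul_le_mul_of_nonneg_right (two_mul_four_pow_le_exp hr) (Real.exp_pos _).le
  have hex : ∃ ω : Fin r × Fin r → Bool,
      ∑ T, Real.exp (∑ e, σ T e * (boolVal (ω e) - q)) ≤ Real.exp (3 * r + r) := by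
    -- If every outcome exceeded the mean bound, equality of the weighted sums would force all
    -- weights to vanish, though they sum to 1.
    by_contra! hcon
    have hw : ∀ ω : Fin r × Fin r → Bool, 0 ≤ ∏ e, bernoulliWeight q (ω e) := fun ω =>
      prod_nonneg fun e _ => by cases ω e <;> simp [bernoulliWeight, hq.le, hq1]
    have hz : ∀ ω : Fin r × Fin r → Bool, ∏ e, bernoulliWeight q (ω e) = 0 := fun ω => by
      have h0 : ∀ ω ∈ (univ : Finset (Fin r × Fin r → Bool)),
          (∏ e, bernoulliWeight q (ω e)) * Real.exp (3 * r + r)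
            ≤ (∏ e, bernoulliWeight q (ω e)) *
              ∑ T, Real.exp (∑ e, σ T e * (boolVal (ω e) - q)) := fun ω _ =>
        mul_le_mul_of_nonneg_left (hcon ω).le (hw ω)
      have h1 := (sum_eq_sum_iff_of_le h0).1 (le_antisymm (sum_le_sum h0) htotal) ω (mem_univ _)
      by_contra hne
      exact (hcon ω).ne (mul_left_cancel₀ hne h1)
    have := sum_prod_bernoulliWeight (ι := Fin r × Fin r) q
    simp [hz] at this
  obtain ⟨ω, hω⟩ := hex
  have hT : ∀ T, ∑ e, σ T e * (boolVal (ω e) - q) ≤ 4 * r := fun T => by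
    have h := (single_le_sum (fun T _ => (Real.exp_pos _).le) (mem_univ T)).trans hω
    have := Real.exp_le_exp.1 h
    linarith
  refine ⟨fun a b => boolVal (ω (a, b)), fun a b => ?_, fun X Y => ?_⟩
  · cases ω (a, b) <;> simp [boolVal]
  · have hσsum : ∀ β, ∑ e, σ (X, Y, β) e * (boolVal (ω e) - q)
        = boolSign β / t * ∑ a ∈ X, ∑ b ∈ Y, (boolVal (ω (a, b)) - q) := fun β => by
      rw [← sum_product', mul_sum]
      simp only [σ, ite_mul, zero_mul]
      rw [← sum_filter, filter_mem_eq_inter, univ_inter]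
    have h1 := hT (X, Y, true)
    have h2 := hT (X, Y, false)
    rw [hσsum] at h1 h2
    have ht0 : 0 < t := by linarith
    simp only [boolSign, if_true, Bool.false_eq_true, if_false] at h1 h2
    rw [div_mul_eq_mul_div, div_le_iff₀ ht0] at h1 h2
    rw [abs_le]
    constructor <;> linarith

end RandomMatrix

/-! ### Blow-ups with nearly equal fibers -/

section Blowup

lemma sum_comp_eq_sum_card_mul {ι κ : Type*} [Fintype κ] [DecidableEq κ] (s : Finset ι)
    (f : ι → κ) (F : κ → ℝ) :
    ∑ i ∈ s, F (f i) = ∑ a, (#{i ∈ s | f i = a} : ℝ) * F a := by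
  rw [← sum_fiberwise s f]
  refine sum_congr rfl fun a _ => ?_
  rw [sum_congr rfl fun i hi => by rw [(mem_filter.1 hi).2], sum_const, nsmul_eq_mul]

/-- Cut norms of blow-ups are controlled by the cut norm of the original matrix. -/
lemma abs_sum_blowup_le {ι μ κ τ : Type*} [Fintype ι] [Fintype μ] [Fintype κ] [Fintype τ]
    [DecidableEq κ] [DecidableEq τ] (f : ι → κ) (g : μ → τ) (B : κ → τ → ℝ) {L L' D : ℝ}
    (hL : 0 < L) (hL' : 0 < L') (hf : ∀ a, (#{i | f i = a} : ℝ) ≤ L)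
    (hg : ∀ b, (#{j | g j = b} : ℝ) ≤ L')
    (hD : ∀ (X : Finset κ) (Y : Finset τ), |∑ a ∈ X, ∑ b ∈ Y, B a b| ≤ D)
    (X : Finset ι) (Y : Finset μ) :
    |∑ i ∈ X, ∑ j ∈ Y, B (f i) (g j)| ≤ L * L' * D := by
  have h := abs_bilin_le_of_abs_cut_le B hD (fun a => (#{i ∈ X | f i = a} : ℝ) / L)
    (fun b => (#{j ∈ Y | g j = b} : ℝ) / L') (fun a => by positivity)
    (fun a => (div_le_one hL).2 (le_trans
      (Nat.cast_le.2 (card_le_card (filter_subset_filter _ (subset_univ _)))) (hf a)))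
    (fun b => by positivity)
    (fun b => (div_le_one hL').2 (le_trans
      (Nat.cast_le.2 (card_le_card (filter_subset_filter _ (subset_univ _)))) (hg b)))
  have e : ∑ i ∈ X, ∑ j ∈ Y, B (f i) (g j) = L * L' * ∑ a, ∑ b, B a b *
      ((#{i ∈ X | f i = a} : ℝ) / L * ((#{j ∈ Y | g j = b} : ℝ) / L')) := by
    rw [sum_comp_eq_sum_card_mul X f fun a => ∑ j ∈ Y, B a (g j), mul_sum]
    refine sum_congr rfl fun a _ => ?_
    rw [sum_comp_eq_sum_card_mul Y g (B a), mul_sum, mul_sum]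
    refine sum_congr rfl fun b _ => ?_
    field_simp
  rw [e, abs_mul, abs_of_pos (mul_pos hL hL')]
  exact mul_le_mul_of_nonneg_left h (mul_pos hL hL').le

/-- The residue map `Fin m → Fin r`. -/
def residue {r : ℕ} (hr : 0 < r) {m : ℕ} (i : Fin m) : Fin r := ⟨i % r, Nat.mod_lt _ hr⟩

/-- Within a residue class the quotient by `r` is injective, giving at most `m / r + 1` elements; `r
≤ m` absorbs the 1. -/
lemma card_residue_fiber_le {r m : ℕ} (hr : 0 < r) (hrm : r ≤ m) (a : Fin r) :
    (#{i : Fin m | residue hr i = a} : ℝ) ≤ 2 * m / r := by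
  have h : #{i : Fin m | residue hr i = a} ≤ #(range (m / r + 1)) := by
    refine card_le_card_of_injOn (fun i => (i : ℕ) / r) (fun i _ => ?_) fun i hi i' hi' h => ?_
    · simp only [coe_range, Set.mem_Iio]
      exact Nat.lt_succ_of_le (Nat.div_le_div_right i.2.le)
    · have hi := (mem_filter.1 hi).2.trans (mem_filter.1 hi').2.symm
      have hmod : (i : ℕ) % r = i' % r := congrArg Fin.val hi
      have hdiv : (i : ℕ) / r = i' / r := h
      rw [Fin.ext_iff, ← Nat.div_add_mod (i : ℕ) r, hmod, hdiv, Nat.div_add_mod]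
  rw [card_range] at h
  have hr' : (0 : ℝ) < r := Nat.cast_pos.2 hr
  have h1 : ((m / r : ℕ) : ℝ) ≤ m / r := Nat.cast_div_le
  have h2 : (1 : ℝ) ≤ m / r := (one_le_div hr').2 (by exact_mod_cast hrm)
  calc (#{i : Fin m | residue hr i = a} : ℝ) ≤ ((m / r + 1 : ℕ) : ℝ) := by exact_mod_cast h
    _ ≤ 2 * m / r := by
        push_cast
        rw [mul_div_assoc]
        linarith

end Blowup

/-! ### Tightness -/

section UpperBound

variable {m n : ℕ}

/-- Both the count of ones and its expected value lie between 0 and the total number of ones. -/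
lemma IsBinary.disc_le_sum {M : Matrix (Fin m) (Fin n) ℝ} (hM : IsBinary M) (hm : 0 < m)
    (hn : 0 < n) : disc M ≤ density M * (m * n) := by
  refine hM.disc_le fun X Y => ?_
  have hp := density_nonneg (M := M)
  have h0 : 0 ≤ ∑ i ∈ X, ∑ j ∈ Y, M i j := sum_nonneg fun i _ => sum_nonneg fun j _ => hM.nonneg i j
  have h1 : ∑ i ∈ X, ∑ j ∈ Y, M i j ≤ density M * (m * n) := by
    rw [← hM.sum_eq hm hn]
    calc ∑ i ∈ X, ∑ j ∈ Y, M i j ≤ ∑ i ∈ X, ∑ j, M i j := sum_le_sum fun i _ =>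
          sum_le_sum_of_subset_of_nonneg (subset_univ _) fun j _ _ => hM.nonneg i j
      _ ≤ ∑ i, ∑ j, M i j := sum_le_sum_of_subset_of_nonneg (subset_univ _) fun i _ _ =>
          sum_nonneg fun j _ => hM.nonneg i j
  have hX : (#X : ℝ) ≤ m := by
    have := card_le_univ X
    rw [Fintype.card_fin] at this
    exact_mod_cast this
  have hY : (#Y : ℝ) ≤ n := by
    have := card_le_univ Y
    rw [Fintype.card_fin] at this
    exact_mod_cast this
  have h2 : (#X : ℝ) * (#Y * density M) ≤ density M * (m * n) := by
    calc (#X : ℝ) * (#Y * density M) ≤ m * (n * density M) := by gcongr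
      _ = density M * (m * n) := by ring
  have h3 : 0 ≤ (#X : ℝ) * (#Y * density M) := by positivity
  simp only [sum_sub_distrib, sum_const, nsmul_eq_mul]
  rw [abs_le]
  constructor <;> linarith

/-- An all-ones block of prescribed approximate density. -/
lemma exists_block (hm : 0 < m) (hn : 0 < n) {p : ℝ} (hp : 1 / ((m : ℝ) * n) ≤ p)
    (hp1 : p ≤ 1 / 2) :
    ∃ M : Matrix (Fin m) (Fin n) ℝ, IsBinary M ∧ M.rank ≤ 1 ∧ p / 2 ≤ density M ∧
      density M ≤ p := by
  have hm' : (0 : ℝ) < m := Nat.cast_pos.2 hm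
  have hn' : (0 : ℝ) < n := Nat.cast_pos.2 hn
  have hmn : (0 : ℝ) < m * n := by positivity
  rw [div_le_iff₀ hmn] at hp
  have hp0 : 0 < p := pos_of_mul_pos_left (by linarith) hmn.le
  have hfloor : ∀ x : ℝ, 1 ≤ x → x / 2 ≤ (⌊x⌋₊ : ℝ) ∧ (⌊x⌋₊ : ℝ) ≤ x := fun x hx => by
    refine ⟨?_, Nat.floor_le (by linarith)⟩
    have h1 := Nat.lt_floor_add_one x
    have h2 : (1 : ℝ) ≤ ⌊x⌋₊ := by exact_mod_cast (Nat.one_le_floor_iff x).2 hx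
    linarith
  obtain ⟨a, b, ha, hb, h1, h2⟩ : ∃ a b : ℕ, a ≤ m ∧ b ≤ n ∧ p * (m * n) / 2 ≤ a * b ∧
      (a * b : ℝ) ≤ p * (m * n) := by
    -- The block is part of a single row, or a number of full rows. Either way one number that is at
    -- least 1 is rounded down, losing at most a factor 2.
    rcases le_total (p * (m * n)) n with h | h
    · obtain ⟨h1, h2⟩ := hfloor _ hp
      refine ⟨1, ⌊p * (m * n)⌋₊, hm, ?_, ?_, ?_⟩
      · exact_mod_cast h2.trans h
      · simpa using h1
      · simpa using h2
    · have hx : 1 ≤ p * m := by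
        by_contra! hlt
        nlinarith
      obtain ⟨h1, h2⟩ := hfloor _ hx
      refine ⟨⌊p * m⌋₊, n, ?_, le_rfl, ?_, ?_⟩
      · have : (⌊p * m⌋₊ : ℝ) ≤ m := by nlinarith
        exact_mod_cast this
      · nlinarith
      · nlinarith
  set M : Matrix (Fin m) (Fin n) ℝ := Matrix.vecMulVec
    (fun i : Fin m => if (i : ℕ) < a then (1 : ℝ) else 0)
    (fun j : Fin n => if (j : ℕ) < b then (1 : ℝ) else 0) with hMdef
  have hM : IsBinary M := fun i j => by
    simp only [hMdef, Matrix.vecMulVec_apply]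
    split_ifs <;> simp
  have hcount : ∀ k N : ℕ, k ≤ N → ∑ i : Fin N, (if (i : ℕ) < k then (1 : ℝ) else 0) = k :=
    fun k N hk => by
      rw [Fin.sum_univ_eq_sum_range (fun i => if i < k then (1 : ℝ) else 0) N, sum_boole]
      congr 1
      have : (range N).filter (fun i => i < k) = range k := by
        ext i
        simp only [mem_filter, mem_range]
        omega
      rw [this, card_range]
  have hsum := hM.sum_eq hm hn
  have hsum' : ∑ i, ∑ j, M i j = a * b := by
    simp only [hMdef, Matrix.vecMulVec_apply, ← mul_sum, ← sum_mul]
    rw [hcount a m ha, hcount b n hb]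
  rw [hsum'] at hsum
  refine ⟨M, hM, Matrix.rank_vecMulVec_le _ _, ?_, ?_⟩
  · refine le_of_mul_le_mul_right ?_ hmn
    linarith
  · refine le_of_mul_le_mul_right ?_ hmn
    linarith

/-- A blow-up of a random matrix. -/
lemma exists_blowup {r : ℕ} (hr : 0 < r) (hrm : r ≤ m) (hrn : r ≤ n) {q : ℝ} (hq1 : q ≤ 1)
    (hqr : 4096 ≤ q * r) :
    ∃ M : Matrix (Fin m) (Fin n) ℝ, IsBinary M ∧ M.rank ≤ r ∧ |density M - q| ≤ q / 4 ∧
      disc M ≤ 32 * (m * n) * (√q / √r) := by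
  have hr' : (0 : ℝ) < r := Nat.cast_pos.2 hr
  have hm : 0 < m := hr.trans_le hrm
  have hn : 0 < n := hr.trans_le hrn
  have hm' : (0 : ℝ) < m := Nat.cast_pos.2 hm
  have hn' : (0 : ℝ) < n := Nat.cast_pos.2 hn
  have hmn : (0 : ℝ) < m * n := by positivity
  have hq : 0 < q := pos_of_mul_pos_left (by linarith) hr'.le
  obtain ⟨Q, hQ, hQc⟩ := exists_binary_cut_le hr hq1 (by linarith : 1 ≤ q * r)
  set M : Matrix (Fin m) (Fin n) ℝ :=
    (Matrix.of Q).submatrix (residue hr) (residue hr) with hMdef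
  have hMe : ∀ i j, M i j = Q (residue hr i) (residue hr j) := fun i j => rfl
  have hM : IsBinary M := fun i j => hQ _ _
  have hE : 2 * m / r * (2 * n / r) * (4 * r * √(q * r)) = 16 * (√q / √r) * (m * n) := by
    rw [Real.sqrt_mul hq.le]
    have : √(r : ℝ) ^ 2 = r := Real.sq_sqrt hr'.le
    have hs : 0 < √(r : ℝ) := Real.sqrt_pos.2 hr'
    field_simp
    rw [this]
    ring
  have hcut : ∀ X Y, |∑ i ∈ X, ∑ j ∈ Y, (M i j - q)| ≤ 16 * (√q / √r) * (m * n) := fun X Y => by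
    rw [← hE]
    exact abs_sum_blowup_le (residue hr) (residue hr) (fun a b => Q a b - q) (by positivity)
      (by positivity) (card_residue_fiber_le hr hrm) (card_residue_fiber_le hr hrn) hQc X Y
  have hdens : |density M - q| ≤ 16 * (√q / √r) := by
    have h := hcut univ univ
    simp only [sum_sub_distrib, sum_const, card_univ, Fintype.card_fin, nsmul_eq_mul] at h
    rw [hM.sum_eq hm hn, show density M * (m * n) - m * (n * q) = (density M - q) * (m * n) by ring,
      abs_mul, abs_of_pos hmn] at h
    exact le_of_mul_le_mul_right h hmn
  refine ⟨M, hM, ?_, ?_, ?_⟩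
  · refine (Matrix.rank_submatrix_le _ _ _).trans ((Matrix.rank_le_card_width _).trans ?_)
    rw [Fintype.card_fin]
  · refine hdens.trans ?_
    -- This is where `4096 = 64²` enters: it makes `16 * (√q / √r) ≤ q / 4`.
    have h1 : 64 ≤ √q * √r := by
      rw [← Real.sqrt_mul hq.le]
      exact Real.le_sqrt_of_sq_le (by linarith)
    have hs : 0 < √(r : ℝ) := Real.sqrt_pos.2 hr'
    have hsq : 0 < √q := Real.sqrt_pos.2 hq
    have e : q = √q ^ 2 := (Real.sq_sqrt hq.le).symm
    rw [mul_div_assoc', div_le_iff₀ hs]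
    nlinarith
  · refine hM.disc_le fun X Y => ?_
    have e : ∑ i ∈ X, ∑ j ∈ Y, (M i j - density M)
        = ∑ i ∈ X, ∑ j ∈ Y, (M i j - q) + #X * (#Y * (q - density M)) := by
      simp only [sum_sub_distrib, sum_const, nsmul_eq_mul]
      ring
    have hX : (#X : ℝ) ≤ m := by
      have := card_le_univ X
      rw [Fintype.card_fin] at this
      exact_mod_cast this
    have hY : (#Y : ℝ) ≤ n := by
      have := card_le_univ Y
      rw [Fintype.card_fin] at this
      exact_mod_cast this
    rw [e]
    refine (abs_add_le _ _).trans ?_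
    have h2 : |(#X : ℝ) * (#Y * (q - density M))| ≤ m * (n * (16 * (√q / √r))) := by
      rw [abs_mul, abs_mul, Nat.abs_cast, Nat.abs_cast, abs_sub_comm]
      gcongr
    have := hcut X Y
    linarith

/-- The lower bound on the discrepancy is attained up to a constant. -/
theorem exists_disc_le {r : ℕ} (hr : 0 < r) (hrm : r ≤ m) (hrn : r ≤ n) {p : ℝ}
    (hp : 1 / ((m : ℝ) * n) ≤ p) (hp1 : p ≤ 1 / 2) :
    ∃ M : Matrix (Fin m) (Fin n) ℝ, IsBinary M ∧ M.rank ≤ r ∧ p / 2 ≤ density M ∧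
      density M ≤ p ∧ disc M ≤ 100 * ((m : ℝ) * n) * min (density M) (√(density M) / √r) := by
  have hr' : (0 : ℝ) < r := Nat.cast_pos.2 hr
  have hm : 0 < m := hr.trans_le hrm
  have hn : 0 < n := hr.trans_le hrn
  have hmn : (0 : ℝ) < m * n := mul_pos (Nat.cast_pos.2 hm) (Nat.cast_pos.2 hn)
  have hs : 0 < √(r : ℝ) := Real.sqrt_pos.2 hr'
  -- Below the threshold `√(p * r) ≤ 100`, so both terms of the minimum dominate the density up to
  -- the factor 100. Above it `3 / 4 * p * r ≥ 6144`, enough for the blow-up.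
  rcases le_total (p * r) 8192 with h | h
  · obtain ⟨M, hM, hrank, hd1, hd2⟩ := exists_block hm hn hp hp1
    refine ⟨M, hM, hrank.trans hr, hd1, hd2, (hM.disc_le_sum hm hn).trans ?_⟩
    have hd0 := density_nonneg (M := M)
    have hmin : density M ≤ 100 * min (density M) (√(density M) / √r) := by
      rw [mul_min_of_nonneg _ _ (by norm_num : (0 : ℝ) ≤ 100)]
      refine le_min (by linarith) ?_
      have h1 : √(density M) * √r ≤ 100 := by
        rw [← Real.sqrt_mul hd0]
        exact Real.sqrt_le_iff.2 ⟨by norm_num, by nlinarith⟩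
      have e : density M = √(density M) ^ 2 := (Real.sq_sqrt hd0).symm
      have h2 := Real.sqrt_nonneg (density M)
      rw [mul_div_assoc', le_div_iff₀ hs]
      nlinarith
    nlinarith
  -- With `q = 3 / 4 * p` and relative error `1 / 4`, the density lies between `9 / 16 * p` and `15
  -- / 16 * p`, inside the required window.
  · obtain ⟨M, hM, hrank, hd, hdisc⟩ := exists_blowup (m := m) (n := n) hr hrm hrn
      (q := 3 / 4 * p) (by linarith) (by linarith)
    rw [abs_le] at hd
    have hp0 : 0 < p := pos_of_mul_pos_left (by linarith) hr'.le
    refine ⟨M, hM, hrank, by linarith, by linarith, hdisc.trans ?_⟩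
    have hd0 : 0 ≤ density M := density_nonneg
    have hmin : min (density M) (√(density M) / √r) = √(density M) / √r := by
      refine min_eq_right ?_
      have h1 : 1 ≤ √(density M) * √r := by
        rw [← Real.sqrt_mul hd0]
        exact Real.one_le_sqrt.2 (by nlinarith)
      have e : density M = √(density M) ^ 2 := (Real.sq_sqrt hd0).symm
      have h2 := Real.sqrt_nonneg (density M)
      rw [div_le_iff₀ hs]
      nlinarith
    have h2 : √(3 / 4 * p) ≤ 2 * √(density M) := by
      refine Real.sqrt_le_iff.2 ⟨by positivity, ?_⟩
      rw [mul_pow, Real.sq_sqrt hd0]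
      linarith
    rw [hmin]
    calc 32 * ((m : ℝ) * n) * (√(3 / 4 * p) / √r)
        ≤ 32 * ((m : ℝ) * n) * (2 * √(density M) / √r) := by gcongr
      _ = 64 * ((m : ℝ) * n) * (√(density M) / √r) := by ring
      _ ≤ 100 * ((m : ℝ) * n) * (√(density M) / √r) := by gcongr; norm_num

end UpperBound

end MatrixDisc

/-- The lower bound on the discrepancy of low-rank binary matrices, and its tightness up to the
constant factor for all values of the parameters. -/
theorem theorem2 :
    (∃ c : ℝ, 0 < c ∧
      ∀ (m n r : ℕ), 0 < m → 0 < n → 0 < r →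
        ∀ M : Matrix (Fin m) (Fin n) ℝ,
          MatrixDisc.IsBinary M → M.rank ≤ r → MatrixDisc.density M ≤ 1 / 2 →
            c * ((m : ℝ) * (n : ℝ)) *
                min (MatrixDisc.density M)
                  (Real.sqrt (MatrixDisc.density M) / Real.sqrt (r : ℝ))
              ≤ MatrixDisc.disc M) ∧
    (∃ C : ℝ, 0 < C ∧
      ∀ (m n r : ℕ), 0 < r → r ≤ m → r ≤ n →
        ∀ p : ℝ, 1 / ((m : ℝ) * (n : ℝ)) ≤ p → p ≤ 1 / 2 →
          ∃ M : Matrix (Fin m) (Fin n) ℝ,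
            MatrixDisc.IsBinary M ∧ M.rank ≤ r ∧
            p / 2 ≤ MatrixDisc.density M ∧ MatrixDisc.density M ≤ p ∧
            MatrixDisc.disc M ≤
              C * ((m : ℝ) * (n : ℝ)) *
                min (MatrixDisc.density M)
                  (Real.sqrt (MatrixDisc.density M) / Real.sqrt (r : ℝ))) :=
  ⟨⟨1 / 40000, by norm_num, fun _ _ _ hm hn hr _ hM hrank hp => hM.le_disc hm hn hr hrank hp⟩,
    ⟨100, by norm_num, fun _ _ _ hr hrm hrn _ hp hp1 =>
      MatrixDisc.exists_disc_le hr hrm hrn hp hp1⟩⟩
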